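/- **Problem.** Let $P:[0,\infty)\to[0,\infty)$ be convex and differentiable (one-sided at $0$). Finitely many jobs arrive over time; job $j$ has release time $r_j\ge 0$, deadline $d_j>r_j$, volume $p_j\ge 0$ and value $a_j\ge 0$. A (preemptive, single-machine) schedule chooses measurable speeds $s_j(t)\ge 0$ with $s_j(t)=0$ unless $r_j\le t<d_j$; job $j$ is completed if $\int_{r_j}^{d_j}s_j(t)\,dt\ge p_j$. Its cost is $\int_0^\infty P\bigl(\sum_j s_j(t)\bigr)dt$ plus the total value of the uncompleted jobs. $\mathrm{OPT}$ denotes the infimum of the costs of all (offline) schedules. **System.** Put $Q(z)=P(z)-zP'(z)$. For a constant $r\ge 1$, a solution of the system is a continuous $v:[0,\infty)\to[0,\infty)$, $u\mapsto v(u)$, differentiable on $(0,\infty)$, with $Q$ differentiable at $v(u)$ for all $u>0$, such that $Q(v(0))=0$ and for all $u>0$ $$Q'(v)\frac{dv}{du}+P'(v)\ \ge\ \frac{P'(u)}{r},\qquad (r-1)P'(u)+r\,Q'(v)\frac{dv}{du}\ \ge\ 0,\qquad \frac{dv}{du}>0 .$$ Let $r^*$ be the smallest constant $r\ge 1$ for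 which the system has a solution. **Algorithm.** Fix a solution $v(\cdot)$ of the system with constant $r^*$. The jobs are handled in the order of their release times (ties in any fixed order). When job $j$ arrives, start with virtual speed $u_j(t)=0$ for all $t$. Write $u(t)=\sum_{k}u_k(t)$ for the sum of the virtual speeds of job $j$ and of all jobs handled before it (accepted or rejected), $v(t)=v(u(t))$ and $\lambda_j=\min_{r_j\le t\le d_j}P'(v(t))$. While $\int_{r_j}^{d_j}u_j(t)\,dt<p_j$ and $\lambda_jp_j<a_j$, continuously increase $u_j(t)$ at times $t\in\arg\min_{r_j\le t\le d_j}P'(v(t))$, updating $u(t)$, $v(t)$ and $\lambda_j$ simultaneously. When the loop ends: if $\int_{r_j}^{d_j}u_j(t)\,dt\ge p_j$, accept $j$ and set its real speed $s_j=u_j$; otherwise (then $\lambda_jp_j\ge a_j$) reject $j$ and set $s_j=0$, keeping the virtual speed $u_j$. **Theorem.** Suppose that $r^*$ exists. Then the algorithm is $r^*$-competitive: for every instance and every solution $v(\cdot)$ of the system with constant $r^*$, the algorithm has a terminating execution, and every terminating execution yields a schedule that completes all accepted jobs and has cost at most $r^*\cdot\mathrm{OPT}$. In particular, if $P(z)=z^\alpha$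 with $\alpha\ge 1$, then $r^*$ exists and equals $\alpha^\alpha$, and the algorithm is $\alpha^\alpha$-competitive. -/

import Mathlib

open Set MeasureTheory
open scoped ENNReal

noncomputable section

namespace EnergyPlusLostValue

/-! ### Jobs, schedules and their cost -/

/-- A job: release time, deadline, processing volume and value. -/
structure Job where
  release : ℝ
  deadline : ℝ
  volume : ℝ
  value : ℝ
  release_nonneg : 0 ≤ release
  release_lt_deadline : release < deadline
  volume_nonneg : 0 ≤ volume
  value_nonneg : 0 ≤ value

/-- The times `r ≤ t < d` at which a job is pending. -/
def Job.pending (J : Job) : Set ℝ := Ico J.release J.deadline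

/-- The closed window `r ≤ t ≤ d` of a job. -/
def Job.window (J : Job) : Set ℝ := Icc J.release J.deadline

/-- The amount of work `∫_r^d f(t) dt` that the speed function `f` does inside the window. -/
def Job.work (J : Job) (f : ℝ → ℝ) : ℝ≥0∞ := ∫⁻ t in J.window, ENNReal.ofReal (f t)

/-- An instance: finitely many jobs, listed in their order of arrival. -/
structure JobSequence where
  n : ℕ
  job : Fin n → Job
  arrival_order : Monotone fun j => (job j).release

/-- A (preemptive, single machine) schedule: `s j t` is the speed spent on job `j` at time `t`;
only pending jobs are processed. -/
structure IsSchedule (I : JobSequence) (s : Fin I.n → ℝ → ℝ) : Prop where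
  measurable : ∀ j, Measurable (s j)
  nonneg : ∀ j t, 0 ≤ s j t
  pending : ∀ j t, t ∉ (I.job j).pending → s j t = 0

/-- The schedule processes the whole volume of job `j`. -/
def Completed (I : JobSequence) (s : Fin I.n → ℝ → ℝ) (j : Fin I.n) : Prop :=
  ENNReal.ofReal (I.job j).volume ≤ (I.job j).work (s j)

/-- The energy `∫_0^∞ P(s(t)) dt`, where `s(t) = ∑ j, s j t` is the speed of the machine. -/
def energy (P : ℝ → ℝ) (I : JobSequence) (s : Fin I.n → ℝ → ℝ) : ℝ≥0∞ :=
  ∫⁻ t in Ici (0 : ℝ), ENNReal.ofReal (P (∑ j, s j t))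

open Classical in
/-- The total value of the jobs that are not completed. -/
def lostValue (I : JobSequence) (s : Fin I.n → ℝ → ℝ) : ℝ≥0∞ :=
  ∑ j, if Completed I s j then 0 else ENNReal.ofReal (I.job j).value

/-- The objective: energy plus lost value. -/
def cost (P : ℝ → ℝ) (I : JobSequence) (s : Fin I.n → ℝ → ℝ) : ℝ≥0∞ :=
  energy P I s + lostValue I s

/-- The optimal offline cost. -/
def optimalCost (P : ℝ → ℝ) (I : JobSequence) : ℝ≥0∞ :=
  ⨅ (s : Fin I.n → ℝ → ℝ) (_ : IsSchedule I s), cost P I s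

/-! ### The system of differential inequalities -/

/-- `P'` for a function `P` on `[0, ∞)`; one-sided at `0`. -/
def marginal (P : ℝ → ℝ) (z : ℝ) : ℝ := derivWithin P (Ici 0) z

/-- `Q(z) = P(z) - z P'(z)`. -/
def Q (P : ℝ → ℝ) (z : ℝ) : ℝ := P z - z * marginal P z

/-- `v : [0, ∞) → [0, ∞)`, as a function of `u`, solves the system with constant `r`:
`Q(v) = 0` at `u = 0`, and for all `u > 0`
`Q'(v) dv/du + P'(v) ≥ P'(u) / r`, `(r - 1) P'(u) + r Q'(v) dv/du ≥ 0` and `dv/du > 0`. -/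
structure SolvesSystem (P : ℝ → ℝ) (r : ℝ) (v : ℝ → ℝ) : Prop where
  nonneg : ∀ u, 0 ≤ u → 0 ≤ v u
  continuousOn : ContinuousOn v (Ici 0)
  boundary : Q P (v 0) = 0
  differentiableAt : ∀ u, 0 < u → DifferentiableAt ℝ v u
  differentiableAt_Q : ∀ u, 0 < u → DifferentiableAt ℝ (Q P) (v u)
  accept : ∀ u, 0 < u → marginal P u / r ≤ deriv (Q P) (v u) * deriv v u + marginal P (v u)
  reject : ∀ u, 0 < u → 0 ≤ (r - 1) * marginal P u + r * (deriv (Q P) (v u) * deriv v u)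
  increasing : ∀ u, 0 < u → 0 < deriv v u

/-- The constants `r ≥ 1` for which the system has a solution. -/
def solvableConstants (P : ℝ → ℝ) : Set ℝ := {r | 1 ≤ r ∧ ∃ v, SolvesSystem P r v}

/-! ### The primal-dual algorithm -/

/-- `λ = min_{r ≤ t ≤ d} P'(v(t))`, where `v(t) = v(U(t))` and `U` is the total virtual speed. -/
def dualPrice (P v : ℝ → ℝ) (J : Job) (U : ℝ → ℝ) : ℝ :=
  sInf ((fun t => marginal P (v (U t))) '' J.window)

/-- `arg min_{r ≤ t ≤ d} P'(v(t))`, where `v(t) = v(U(t))`. -/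
def argMin (P v : ℝ → ℝ) (J : Job) (U : ℝ → ℝ) : Set ℝ :=
  {t | t ∈ J.window ∧ ∀ t' ∈ J.window, marginal P (v (U t)) ≤ marginal P (v (U t'))}

/-- The guard of the while loop for job `J`: `x` is the current virtual speed on `J`, and `U` is
the total virtual speed on the earlier jobs. -/
def LoopGuard (P v : ℝ → ℝ) (J : Job) (U x : ℝ → ℝ) : Prop :=
  J.work x < ENNReal.ofReal J.volume ∧
    dualPrice P v J (fun t => U t + x t) * J.volume < J.value

/-- A terminating run of the while loop for job `J` on top of the total virtual speed `U` of the
earlier jobs. Here `τ ∈ [0, T]` is the moment in the execution, and `w τ t` is the virtual speed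
on `J` at time `t` as it stands at moment `τ`. It is increased continuously, and at the time `t`
only at moments at which `t` belongs to the current arg min. -/
structure IsWhileLoop (P v : ℝ → ℝ) (J : Job) (U : ℝ → ℝ) (T : ℝ) (w : ℝ → ℝ → ℝ) : Prop where
  nonneg : 0 ≤ T
  init : ∀ t, w 0 t = 0
  measurable : ∀ τ ∈ Icc 0 T, Measurable (w τ)
  outside : ∀ τ ∈ Icc 0 T, ∀ t, t ∉ J.window → w τ t = 0
  monotoneOn : ∀ t, MonotoneOn (fun τ => w τ t) (Icc 0 T)
  continuousOn : ∀ t, ContinuousOn (fun τ => w τ t) (Icc 0 T)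
  increase_argMin : ∀ t, ∀ σ ∈ Icc 0 T, ∀ τ ∈ Icc 0 T, σ ≤ τ → w σ t < w τ t →
    ∃ ρ ∈ Icc σ τ, t ∈ argMin P v J (fun t' => U t' + w ρ t')
  guard : ∀ τ ∈ Ico 0 T, LoopGuard P v J U (w τ)
  exit : ¬ LoopGuard P v J U (w T)

/-- `u j` is the virtual speed on job `j` at the end of its while loop, the jobs being handled one
after the other in their order of arrival. The virtual speeds of rejected jobs are kept. -/
def IsExecution (P v : ℝ → ℝ) (I : JobSequence) (u : Fin I.n → ℝ → ℝ) : Prop :=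
  ∀ j, ∃ T w, IsWhileLoop P v (I.job j) (fun t => ∑ k ∈ Finset.Iio j, u k t) T w ∧ u j = w T

/-- Job `j` is accepted if its virtual speed covers its volume when the loop ends; otherwise the
loop ended because `λ p` reached the value of the job, and the job is rejected. -/
def Accepted (I : JobSequence) (u : Fin I.n → ℝ → ℝ) (j : Fin I.n) : Prop :=
  ENNReal.ofReal (I.job j).volume ≤ (I.job j).work (u j)

open Classical in
/-- The real speeds: the virtual one for accepted jobs (while they are pending, that is, except at
the very instant of the deadline), and `0` for rejected jobs. -/
def realSpeed (I : JobSequence) (u : Fin I.n → ℝ → ℝ) (j : Fin I.n) : ℝ → ℝ :=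
  if Accepted I u j then (I.job j).pending.indicator (u j) else 0

/-- The algorithm that keeps `v(t) = v(u(t))` is `c`-competitive: on every instance it has an
execution, and every execution yields a schedule that completes all accepted jobs and whose cost
is at most `c` times the optimal offline cost. -/
def AlgorithmCompetitive (P v : ℝ → ℝ) (c : ℝ) : Prop :=
  ∀ I : JobSequence,
    (∃ u, IsExecution P v I u) ∧
    ∀ u, IsExecution P v I u →
      IsSchedule I (realSpeed I u) ∧
      (∀ j, Accepted I u j → Completed I (realSpeed I u) j) ∧
      cost P I (realSpeed I u) ≤ ENNReal.ofReal c * optimalCost P I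

end EnergyPlusLostValue

end

noncomputable section

namespace EnergyPlusLostValue

open Filter Topology

/-! ### Convex power functions -/

/-! The proof is primal-dual. For the final total virtual speed `u(t)`, put `v(t) = v(u(t))` and let
`λ_j` be the price of job `j` at the end of its loop. The tangent of `P` at `v(t)` gives `Q(v(t)) +
P'(v(t)) S ≤ P(S)` for every speed `S`, and `λ_j ≤ P'(v(t))` on the window of `j`. So every schedule
costs at least `∑ min(λ_j p_j, a_j) + ∫ Q(v(t)) dt` (`dual_le_cost_add_defect`).

The system is what lets the algorithm pay for itself against this bound. Integrated over the
increase of `u` due to one job, its inequalities show that an accepted job raises energy plus `-r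
Q(v)` by at most `r λ_j u_j(t)`, and a rejected one raises `-r Q(v)` by at most `(r - 1) λ_j
u_j(t)`, which leaves one share to pay for the lost value (`pointwise_cost_le`,
`cost_add_defect_le`). Here it matters that `v` has price exactly `λ_j` wherever `u_j > 0`
(`IsWhileLoop.price_eq_of_pos`). Comparing both bounds and cancelling the finite defect gives the
ratio `r`.

Executions exist by water filling. For `P(z) = z^α`, `v(u) = u/α` solves the system with `α^α`; for
a smaller constant, `v(u)/u` would fall at least as fast as a multiple of `-log u` and become
nonpositive. -/

lemma continuousOn_of_monotoneOn_of_ordConnected_image {f : ℝ → ℝ} {s : Set ℝ}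
    (hf : MonotoneOn f s) (hs : OrdConnected (f '' s)) : ContinuousOn f s := by
  intro a ha
  refine tendsto_order.2 ⟨fun b hb => ?_, fun b hb => ?_⟩
  · by_cases h : ∃ x ∈ s, f x ≤ b
    · obtain ⟨x, hx, hxb⟩ := h
      obtain ⟨m, hm, hma⟩ := exists_between hb
      obtain ⟨c, hc, rfl⟩ := hs.out (mem_image_of_mem f hx) (mem_image_of_mem f ha)
        ⟨hxb.trans hm.le, hma.le⟩
      have hca : c < a := not_le.1 fun h => hma.not_ge (hf ha hc h)
      filter_upwards [self_mem_nhdsWithin, mem_nhdsWithin_of_mem_nhds (Ioi_mem_nhds hca)]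
        with y hy hcy using hm.trans_le (hf hc hy (le_of_lt hcy))
    · push Not at h
      filter_upwards [self_mem_nhdsWithin] with y hy using h y hy
  · by_cases h : ∃ x ∈ s, b ≤ f x
    · obtain ⟨x, hx, hxb⟩ := h
      obtain ⟨m, hm, hma⟩ := exists_between hb
      obtain ⟨c, hc, rfl⟩ := hs.out (mem_image_of_mem f ha) (mem_image_of_mem f hx)
        ⟨hm.le, hma.le.trans hxb⟩
      have hca : a < c := not_le.1 fun h => hm.not_ge (hf hc ha h)
      filter_upwards [self_mem_nhdsWithin, mem_nhdsWithin_of_mem_nhds (Iio_mem_nhds hca)]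
        with y hy hcy using (hf hy hc (le_of_lt hcy)).trans_lt hma
    · push Not at h
      filter_upwards [self_mem_nhdsWithin] with y hy using h y hy

section Convex

variable {P : ℝ → ℝ} (hc : ConvexOn ℝ (Ici 0) P) (hd : DifferentiableOn ℝ P (Ici 0))

include hc hd

lemma monotoneOn_marginal : MonotoneOn (marginal P) (Ici 0) := hc.monotoneOn_derivWithin hd

/-- A monotone function can only jump, and a derivative cannot jump because it has the Darboux
property. -/
lemma continuousOn_marginal : ContinuousOn (marginal P) (Ici 0) :=
  continuousOn_of_monotoneOn_of_ordConnected_image (monotoneOn_marginal hc hd)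
    (ordConnected_Ici.image_derivWithin hd)

lemma tangent_le {y z : ℝ} (hy : 0 ≤ y) (hz : 0 ≤ z) :
    P y + marginal P y * (z - y) ≤ P z := by
  rcases lt_trichotomy y z with h | rfl | h
  · have := hc.derivWithin_le_slope hy hz h (hd y hy)
    rw [slope_def_field, le_div_iff₀ (sub_pos.2 h)] at this
    unfold marginal; linarith
  · simp
  · have := hc.slope_le_derivWithin hz hy h (hd y hy)
    rw [slope_def_field, div_le_iff₀ (sub_pos.2 h)] at this
    unfold marginal; linarith

/-- `Q(z)` is the intercept at `0` of the tangent at `z`, and this drops as the point of tangency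
moves right. -/
lemma antitoneOn_Q : AntitoneOn (Q P) (Ici 0) := by
  intro a ha b hb hab
  have h1 := tangent_le hc hd hb ha
  have h2 := mul_le_mul_of_nonneg_left (monotoneOn_marginal hc hd ha hb hab) (mem_Ici.1 ha)
  unfold Q; linarith

lemma continuousOn_Q : ContinuousOn (Q P) (Ici 0) :=
  hd.continuousOn.sub (continuousOn_id.mul (continuousOn_marginal hc hd))

lemma marginal_nonneg (hnn : ∀ z, 0 ≤ z → 0 ≤ P z) (h0 : P 0 = 0) {z : ℝ} (hz : 0 ≤ z) :
    0 ≤ marginal P z := by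
  refine le_trans ?_ (monotoneOn_marginal hc hd self_mem_Ici hz hz)
  have h : Tendsto (slope P 0) (𝓝[>] 0) (𝓝 (marginal P 0)) := by
    have := (hd 0 self_mem_Ici).hasDerivWithinAt
    rwa [hasDerivWithinAt_iff_tendsto_slope, Ici_sdiff_left] at this
  refine ge_of_tendsto h ?_
  filter_upwards [self_mem_nhdsWithin] with y hy
  rw [slope_def_field, h0]
  have hy : (0 : ℝ) < y := hy
  exact div_nonneg (by linarith [hnn y hy.le]) (by linarith)

/-- Increments of a convex function grow with the base point. This transfers energy estimates from
the virtual speed to the smaller real speed, which omits the rejected jobs. -/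
lemma add_sub_le_add_sub {s u x : ℝ} (hs : 0 ≤ s) (hsu : s ≤ u) (hx : 0 ≤ x) :
    P (s + x) - P s ≤ P (u + x) - P u := by
  rcases hx.eq_or_lt with rfl | hx
  · simp
  have h1 := tangent_le hc hd (y := s + x) (z := s) (by linarith) hs
  rcases le_total (s + x) u with h | h
  · have h2 := tangent_le hc hd (y := u) (z := u + x) (by linarith) (by linarith)
    have h3 := monotoneOn_marginal hc hd (show 0 ≤ s + x by linarith)
      (show 0 ≤ u by linarith) h
    nlinarith
  · have h4 := hc.2 (x := s) (y := u + x) hs (show 0 ≤ u + x by linarith)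
    have hL : 0 < u + x - s := by linarith
    have e1 := h4 (a := x / (u + x - s)) (b := (u - s) / (u + x - s)) (by positivity)
      (div_nonneg (by linarith) hL.le) (by field_simp; ring)
    have e2 := h4 (a := (u - s) / (u + x - s)) (b := x / (u + x - s))
      (div_nonneg (by linarith) hL.le) (by positivity) (by field_simp; ring)
    have f1 : (x / (u + x - s)) • s + ((u - s) / (u + x - s)) • (u + x) = u := by
      simp only [smul_eq_mul]; field_simp; ring
    have f2 : ((u - s) / (u + x - s)) • s + (x / (u + x - s)) • (u + x) = s + x := by
      simp only [smul_eq_mul]; field_simp; ring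
    rw [f1] at e1
    rw [f2] at e2
    have g : x / (u + x - s) + (u - s) / (u + x - s) = 1 := by field_simp; ring
    simp only [smul_eq_mul] at e1 e2
    linear_combination e1 + e2 + (P s + P (u + x)) * g

end Convex

/-! ### Solutions of the system -/

section Solution

variable {P v : ℝ → ℝ} {r : ℝ} (hc : ConvexOn ℝ (Ici 0) P) (hd : DifferentiableOn ℝ P (Ici 0))
  (hv : SolvesSystem P r v)

include hv

lemma SolvesSystem.monotoneOn : MonotoneOn v (Ici 0) := by
  refine (strictMonoOn_of_deriv_pos (convex_Ici 0) hv.continuousOn fun x hx => ?_).monotoneOn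
  rw [interior_Ici] at hx
  exact hv.increasing x hx

lemma SolvesSystem.mapsTo : MapsTo v (Ici 0) (Ici 0) := fun u hu => hv.nonneg u hu

include hc hd

lemma SolvesSystem.monotoneOn_price : MonotoneOn (fun u => marginal P (v u)) (Ici 0) :=
  (monotoneOn_marginal hc hd).comp hv.monotoneOn hv.mapsTo

lemma SolvesSystem.continuousOn_price : ContinuousOn (fun u => marginal P (v u)) (Ici 0) :=
  (continuousOn_marginal hc hd).comp hv.continuousOn hv.mapsTo

lemma SolvesSystem.antitoneOn_Q : AntitoneOn (fun u => Q P (v u)) (Ici 0) :=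
  fun _ ha _ hb hab => EnergyPlusLostValue.antitoneOn_Q hc hd (hv.mapsTo ha) (hv.mapsTo hb)
    (hv.monotoneOn ha hb hab)

lemma SolvesSystem.continuousOn_Q : ContinuousOn (fun u => Q P (v u)) (Ici 0) :=
  (EnergyPlusLostValue.continuousOn_Q hc hd).comp hv.continuousOn hv.mapsTo

lemma SolvesSystem.Q_nonpos {u : ℝ} (hu : 0 ≤ u) : Q P (v u) ≤ 0 := by
  have := hv.antitoneOn_Q hc hd self_mem_Ici hu hu
  simpa [hv.boundary] using this

omit hc hd in
lemma SolvesSystem.hasDerivAt_Q {u : ℝ} (hu : 0 < u) :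
    HasDerivAt (fun u => Q P (v u)) (deriv (Q P) (v u) * deriv v u) u :=
  (hv.differentiableAt_Q u hu).hasDerivAt.comp u (hv.differentiableAt u hu).hasDerivAt

/-- Integrated form of the first inequality of the system. -/
lemma SolvesSystem.energy_increment (hr : 1 ≤ r) {u x : ℝ} (hu : 0 ≤ u) (hx : 0 ≤ x) :
    P (u + x) - P u ≤
      r * (Q P (v (u + x)) - Q P (v u)) + r * (marginal P (v (u + x)) * x) := by
  have hsub : Icc u (u + x) ⊆ Ici 0 := fun y hy => hu.trans hy.1
  -- The price is frozen at its final, largest value, so the first inequality of the system makes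
  -- the derivative nonnegative.
  have hmono : MonotoneOn (fun y => r * Q P (v y) + r * (marginal P (v (u + x)) * y) - P y)
      (Icc u (u + x)) := by
    refine monotoneOn_of_hasDerivWithinAt_nonneg (convex_Icc _ _)
      (f' := fun y => r * (deriv (Q P) (v y) * deriv v y) + r * (marginal P (v (u + x)) * 1)
        - marginal P y) ?_ ?_ ?_
    · exact ((continuousOn_const.mul ((hv.continuousOn_Q hc hd).mono hsub)).add
        (continuousOn_const.mul (continuousOn_const.mul continuousOn_id))).sub
        (hd.continuousOn.mono hsub)
    · intro y hy
      rw [interior_Icc] at hy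
      have hy0 : 0 < y := hu.trans_lt hy.1
      have hP : HasDerivAt P (marginal P y) y :=
        (hd y hy0.le).hasDerivWithinAt.hasDerivAt (Ici_mem_nhds hy0)
      exact ((((hv.hasDerivAt_Q hy0).const_mul r).add
        (((hasDerivAt_id y).const_mul _).const_mul r)).sub hP).hasDerivWithinAt
    · intro y hy
      rw [interior_Icc] at hy
      have hy0 : 0 < y := hu.trans_lt hy.1
      have h1 := hv.accept y hy0
      have h2 : marginal P (v y) ≤ marginal P (v (u + x)) :=
        hv.monotoneOn_price hc hd hy0.le (show (0 : ℝ) ≤ u + x by linarith) hy.2.le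
      rw [div_le_iff₀ (by linarith)] at h1
      nlinarith
  have := hmono (left_mem_Icc.2 (by linarith)) (right_mem_Icc.2 (by linarith))
    (show u ≤ u + x by linarith)
  simp only at this
  linarith

/-- Integrated form of the second inequality of the system, combined with the first one. -/
lemma SolvesSystem.Q_decrement (hr : 1 ≤ r) {u x : ℝ} (hu : 0 ≤ u) (hx : 0 ≤ x) :
    r * (Q P (v u) - Q P (v (u + x))) ≤ (r - 1) * (marginal P (v (u + x)) * x) := by
  have hsub : Icc u (u + x) ⊆ Ici 0 := fun y hy => hu.trans hy.1
  have hmono : MonotoneOn (fun y => r * Q P (v y) + (r - 1) * (marginal P (v (u + x)) * y))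
      (Icc u (u + x)) := by
    refine monotoneOn_of_hasDerivWithinAt_nonneg (convex_Icc _ _)
      (f' := fun y => r * (deriv (Q P) (v y) * deriv v y)
        + (r - 1) * (marginal P (v (u + x)) * 1)) ?_ ?_ ?_
    · exact (continuousOn_const.mul ((hv.continuousOn_Q hc hd).mono hsub)).add
        (continuousOn_const.mul (continuousOn_const.mul continuousOn_id))
    · intro y hy
      rw [interior_Icc] at hy
      have hy0 : 0 < y := hu.trans_lt hy.1
      exact (((hv.hasDerivAt_Q hy0).const_mul r).add
        (((hasDerivAt_id y).const_mul _).const_mul (r - 1))).hasDerivWithinAt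
    · intro y hy
      rw [interior_Icc] at hy
      have hy0 : 0 < y := hu.trans_lt hy.1
      have h1 := hv.accept y hy0
      have h3 := hv.reject y hy0
      have h2 : marginal P (v y) ≤ marginal P (v (u + x)) :=
        hv.monotoneOn_price hc hd hy0.le (show (0 : ℝ) ≤ u + x by linarith) hy.2.le
      rw [div_le_iff₀ (by linarith)] at h1
      -- The first inequality, times `r - 1`, eliminates `P'(y)` from the second and leaves a bound
      -- in terms of `P'(v(y))` alone.
      have h4 := mul_le_mul_of_nonneg_left h1 (sub_nonneg.2 hr)
      have h5 := mul_le_mul_of_nonneg_left h2 (sub_nonneg.2 hr)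
      have h6 : 0 ≤ r * (r * (deriv (Q P) (v y) * deriv v y)
          + (r - 1) * marginal P (v y)) := by nlinarith
      have h7 := nonneg_of_mul_nonneg_right h6 (by linarith)
      linarith
  have := hmono (left_mem_Icc.2 (by linarith)) (right_mem_Icc.2 (by linarith))
    (show u ≤ u + x by linarith)
  simp only at this
  linarith

end Solution

/-! ### Runs of the while loop -/

section Loop

variable {P v : ℝ → ℝ} {J : Job} {U X Y : ℝ → ℝ} {T : ℝ} {w : ℝ → ℝ → ℝ}
  (hmono : MonotoneOn (fun u => marginal P (v u)) (Ici 0))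
  (hcont : ContinuousOn (fun u => marginal P (v u)) (Ici 0))

lemma Job.window_nonempty (J : Job) : J.window.Nonempty :=
  nonempty_Icc.2 J.release_lt_deadline.le

section Price

include hmono

lemma bddBelow_price_image (hX : ∀ t, 0 ≤ X t) :
    BddBelow ((fun t => marginal P (v (X t))) '' J.window) :=
  ⟨marginal P (v 0), by rintro _ ⟨t, -, rfl⟩; exact hmono self_mem_Ici (hX t) (hX t)⟩

lemma dualPrice_le (hX : ∀ t, 0 ≤ X t) {t : ℝ} (ht : t ∈ J.window) :
    dualPrice P v J X ≤ marginal P (v (X t)) :=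
  csInf_le (bddBelow_price_image hmono hX) ⟨t, ht, rfl⟩

omit hmono in
lemma le_dualPrice {c : ℝ} (h : ∀ t ∈ J.window, c ≤ marginal P (v (X t))) :
    c ≤ dualPrice P v J X :=
  le_csInf (J.window_nonempty.image _) (by rintro _ ⟨t, ht, rfl⟩; exact h t ht)

lemma dualPrice_mono (hX : ∀ t, 0 ≤ X t) (hXY : ∀ t, X t ≤ Y t) :
    dualPrice P v J X ≤ dualPrice P v J Y :=
  le_dualPrice fun t ht => (dualPrice_le hmono hX ht).trans
    (hmono (hX t) ((hX t).trans (hXY t)) (hXY t))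

end Price

variable (hw : IsWhileLoop P v J U T w) (hU : ∀ t, 0 ≤ U t)

include hw

lemma IsWhileLoop.speed_nonneg {τ : ℝ} (hτ : τ ∈ Icc 0 T) (t : ℝ) : 0 ≤ w τ t := by
  have := hw.monotoneOn t (left_mem_Icc.2 hw.nonneg) hτ hτ.1
  simpa [hw.init] using this

lemma IsWhileLoop.mem_window_of_pos {τ t : ℝ} (hτ : τ ∈ Icc 0 T) (ht : 0 < w τ t) :
    t ∈ J.window := by
  by_contra h
  exact ht.ne' (hw.outside τ hτ t h)

lemma IsWhileLoop.end_pos_of_pos {t : ℝ} (ht : 0 < w T t) : 0 < T := by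
  rcases hw.nonneg.eq_or_lt with rfl | h
  · rw [hw.init] at ht
    exact absurd ht (lt_irrefl _)
  · exact h

include hmono hcont hU

/-- A time whose virtual speed has been increased stays in the `arg min`. -/
lemma IsWhileLoop.price_eq_of_pos {τ t : ℝ} (hτ : τ ∈ Icc 0 T) (ht : 0 < w τ t) :
    marginal P (v (U t + w τ t)) = dualPrice P v J (fun t' => U t' + w τ t') := by
  have hX : ∀ σ ∈ Icc 0 T, ∀ t', 0 ≤ U t' + w σ t' :=
    fun σ hσ t' => add_nonneg (hU t') (hw.speed_nonneg hσ t')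
  refine le_antisymm ?_ (dualPrice_le hmono (X := fun t' => U t' + w τ t') (hX τ hτ)
    (hw.mem_window_of_pos hτ ht))
  -- Each level `y` below the current one was passed at some moment `σ`, and at some later moment
  -- `ρ` the time `t` was in the arg min. The price at `y` is thus at most the minimum at `ρ`, which
  -- has not decreased since. Then `y` tends to the current level.
  have key : ∀ y ∈ Ioo (U t) (U t + w τ t),
      marginal P (v y) ≤ dualPrice P v J (fun t' => U t' + w τ t') := by
    intro y hy
    have hsub : Icc 0 τ ⊆ Icc 0 T := Icc_subset_Icc_right hτ.2
    obtain ⟨σ, hσ, hσy⟩ : y - U t ∈ (fun σ => w σ t) '' Icc 0 τ := by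
      refine intermediate_value_Icc hτ.1 ((hw.continuousOn t).mono hsub) ?_
      rw [hw.init]
      constructor <;> linarith [hy.1, hy.2]
    simp only at hσy
    obtain ⟨ρ, hρ, hρmin⟩ := hw.increase_argMin t σ (hsub hσ) τ hτ hσ.2 (by linarith [hy.2])
    have hρT : ρ ∈ Icc 0 T := ⟨hσ.1.trans hρ.1, hρ.2.trans hτ.2⟩
    have h1 : w σ t ≤ w ρ t := hw.monotoneOn t (hsub hσ) hρT hρ.1
    calc marginal P (v y) ≤ marginal P (v (U t + w ρ t)) :=
          hmono ((hU t).trans hy.1.le) (hX ρ hρT t) (by linarith)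
      _ ≤ dualPrice P v J (fun t' => U t' + w ρ t') := le_dualPrice hρmin.2
      _ ≤ dualPrice P v J (fun t' => U t' + w τ t') :=
          dualPrice_mono hmono (hX ρ hρT) fun t' => by
            linarith [hw.monotoneOn t' hρT hτ hρ.2]
  have hpos : 0 < U t + w τ t := by linarith [hU t]
  have hlim : Tendsto (fun u => marginal P (v u)) (𝓝[<] (U t + w τ t))
      (𝓝 (marginal P (v (U t + w τ t)))) :=
    (hcont.continuousAt (Ici_mem_nhds hpos)).tendsto.mono_left nhdsWithin_le_nhds
  refine le_of_tendsto hlim ?_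
  filter_upwards [Ioo_mem_nhdsLT (show U t < U t + w τ t by linarith)] with y hy using key y hy

/-- The guard holds at all moments before `T`. Near `T` the dual price equals the price at `t`,
which is continuous in the moment, so the inequality passes to the limit. -/
lemma IsWhileLoop.price_mul_volume_le {t : ℝ} (ht : 0 < w T t) :
    dualPrice P v J (fun t' => U t' + w T t') * J.volume ≤ J.value := by
  have hT := hw.end_pos_of_pos ht
  have hTm : T ∈ Icc 0 T := ⟨hT.le, le_rfl⟩
  rw [← hw.price_eq_of_pos hmono hcont hU hTm ht]
  have hwlim : Tendsto (fun σ => w σ t) (𝓝[<] T) (𝓝 (w T t)) := by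
    have h := (hw.continuousOn t T hTm).mono Ico_subset_Icc_self
    rwa [ContinuousWithinAt, nhdsWithin_Ico_eq_nhdsLT hT] at h
  have hpos : 0 < U t + w T t := by linarith [hU t]
  have hlim : Tendsto (fun σ => marginal P (v (U t + w σ t)) * J.volume) (𝓝[<] T)
      (𝓝 (marginal P (v (U t + w T t)) * J.volume)) :=
    (Tendsto.comp (hcont.continuousAt (Ici_mem_nhds hpos)).tendsto
      (hwlim.const_add (U t))).mul_const _
  refine le_of_tendsto hlim ?_
  filter_upwards [hwlim.eventually_const_lt ht, Ioo_mem_nhdsLT hT] with σ h1 h2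
  rw [hw.price_eq_of_pos hmono hcont hU ⟨h2.1.le, h2.2.le⟩ h1]
  exact (hw.guard σ ⟨h2.1.le, h2.2⟩).2.le

omit hmono hcont hU

/-- The work stays below the volume before `T`, and monotone convergence along moments increasing to
`T` gives the bound at `T`. -/
lemma IsWhileLoop.work_le : J.work (w T) ≤ ENNReal.ofReal J.volume := by
  rcases hw.nonneg.eq_or_lt with rfl | hT
  · simp [Job.work, hw.init]
  have hTm : T ∈ Icc 0 T := ⟨hT.le, le_rfl⟩
  let σ : ℕ → ℝ := fun n => T - T * (1 / ((n : ℝ) + 1))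
  have hσ : ∀ n, σ n ∈ Ico 0 T := by
    intro n
    have h1 : 0 < 1 / ((n : ℝ) + 1) := by positivity
    have h2 : 1 / ((n : ℝ) + 1) ≤ 1 := by
      rw [div_le_one (by positivity)]; linarith [n.cast_nonneg (α := ℝ)]
    constructor
    · simp only [σ]; nlinarith
    · simp only [σ]; nlinarith
  have hσ' : ∀ n, σ n ∈ Icc 0 T := fun n => Ico_subset_Icc_self (hσ n)
  have hσlim : Tendsto σ atTop (𝓝 T) := by
    simpa [σ] using (tendsto_one_div_add_atTop_nhds_zero_nat (𝕜 := ℝ)).const_mul T |>.const_sub T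
  have hσmono : Monotone σ := by
    intro m n hmn
    have : 1 / ((n : ℝ) + 1) ≤ 1 / ((m : ℝ) + 1) := Nat.one_div_le_one_div hmn
    simp only [σ]; nlinarith
  have hlim : Tendsto (fun n => J.work (w (σ n))) atTop (𝓝 (J.work (w T))) := by
    refine lintegral_tendsto_of_tendsto_of_monotone
      (fun n => (hw.measurable _ (hσ' n)).ennreal_ofReal.aemeasurable)
      (Eventually.of_forall fun t m n hmn => ENNReal.ofReal_le_ofReal
        (hw.monotoneOn t (hσ' m) (hσ' n) (hσmono hmn)))
      (Eventually.of_forall fun t => ?_)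
    refine (ENNReal.continuous_ofReal.tendsto _).comp ?_
    exact (hw.continuousOn t T hTm).tendsto.comp
      (tendsto_nhdsWithin_iff.2 ⟨hσlim, Eventually.of_forall hσ'⟩)
  exact le_of_tendsto' hlim fun n => (hw.guard _ (hσ n)).1.le

end Loop

/-! ### Schedules and executions -/

lemma Job.window_subset (J : Job) : J.window ⊆ Ici 0 :=
  fun _ ht => J.release_nonneg.trans ht.1

lemma Job.work_eq_of_zero_outside {J : Job} {f : ℝ → ℝ} (hf : ∀ t, t ∉ J.window → f t = 0) :
    ∫⁻ t in Ici (0 : ℝ), ENNReal.ofReal (f t) = J.work f := by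
  have hs : (fun t => ENNReal.ofReal (f t)).support ⊆ J.window := by
    intro t ht
    by_contra h
    exact ht (by simp [hf t h])
  rw [Job.work, setLIntegral_eq_of_support_subset hs,
    setLIntegral_eq_of_support_subset (hs.trans J.window_subset)]

lemma Job.work_indicator_pending (J : Job) (f : ℝ → ℝ) :
    J.work (J.pending.indicator f) = J.work f := by
  have h : J.pending =ᵐ[MeasureTheory.volume] J.window := Ico_ae_eq_Icc
  rw [Job.work, Job.work, ← setLIntegral_congr h, ← setLIntegral_congr h]
  exact setLIntegral_congr_fun measurableSet_Ico fun t ht => by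
    simp only [indicator_of_mem ht]

/-- Induction along the order of arrival. -/
lemma induction_Iio {n : ℕ} {motive : Finset (Fin n) → Prop} (empty : motive ∅)
    (step : ∀ j, motive (Finset.Iio j) → motive (insert j (Finset.Iio j))) :
    motive Finset.univ := by
  have key : ∀ m ≤ n, motive (Finset.univ.filter fun j : Fin n => j.val < m) := by
    intro m
    induction m with
    | zero => intro _; simpa using empty
    | succ m ih =>
      intro hm
      have e1 : (Finset.univ.filter fun j : Fin n => j.val < m) = Finset.Iio ⟨m, hm⟩ := by
        ext j; simp [Fin.lt_def]
      have e2 : (Finset.univ.filter fun j : Fin n => j.val < m + 1)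
          = insert ⟨m, hm⟩ (Finset.Iio ⟨m, hm⟩) := by
        ext j
        simp only [Finset.mem_filter_univ, Finset.mem_insert, Finset.mem_Iio, Fin.lt_def,
          Fin.ext_iff]
        omega
      rw [e2]
      exact step _ (e1 ▸ ih (by omega))
  have := key n le_rfl
  rwa [Finset.filter_true_of_mem fun j _ => j.isLt] at this

section Execution

variable {P v : ℝ → ℝ} {I : JobSequence} {u : Fin I.n → ℝ → ℝ}

section Basic

variable (hu : IsExecution P v I u)

include hu

lemma IsExecution.nonneg (j : Fin I.n) (t : ℝ) : 0 ≤ u j t := by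
  obtain ⟨T, w, hw, h⟩ := hu j
  exact h ▸ hw.speed_nonneg ⟨hw.nonneg, le_rfl⟩ t

lemma IsExecution.measurable (j : Fin I.n) : Measurable (u j) := by
  obtain ⟨T, w, hw, h⟩ := hu j
  exact h ▸ hw.measurable T ⟨hw.nonneg, le_rfl⟩

lemma IsExecution.outside (j : Fin I.n) (t : ℝ) (ht : t ∉ (I.job j).window) : u j t = 0 := by
  obtain ⟨T, w, hw, h⟩ := hu j
  exact h ▸ hw.outside T ⟨hw.nonneg, le_rfl⟩ t ht

lemma IsExecution.work_le (j : Fin I.n) :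
    (I.job j).work (u j) ≤ ENNReal.ofReal (I.job j).volume := by
  obtain ⟨T, w, hw, h⟩ := hu j
  exact h ▸ hw.work_le

lemma IsExecution.isSchedule : IsSchedule I (realSpeed I u) where
  measurable j := by
    unfold realSpeed
    split_ifs
    · exact (hu.measurable j).indicator measurableSet_Ico
    · exact measurable_zero
  nonneg j t := by
    unfold realSpeed
    split_ifs
    · exact indicator_nonneg (fun t _ => hu.nonneg j t) t
    · exact le_rfl
  pending j t ht := by
    unfold realSpeed
    split_ifs
    · exact indicator_of_notMem ht _
    · rfl

lemma IsExecution.realSpeed_le (j : Fin I.n) (t : ℝ) : realSpeed I u j t ≤ u j t := by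
  unfold realSpeed
  split_ifs
  · exact indicator_le_self' (fun t _ => hu.nonneg j t) t
  · exact hu.nonneg j t

end Basic

lemma completed_of_accepted {j : Fin I.n} (h : Accepted I u j) :
    Completed I (realSpeed I u) j := by
  rw [Completed, realSpeed, if_pos h, Job.work_indicator_pending]
  exact h

/-- The price of job `j` at the end of its while loop. -/
def finalPrice (P v : ℝ → ℝ) (I : JobSequence) (u : Fin I.n → ℝ → ℝ) (j : Fin I.n) : ℝ :=
  dualPrice P v (I.job j) fun t => ∑ k ∈ Finset.Iio j, u k t + u j t

/-- The contribution of job `j` to the dual objective. -/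
def dualShare (P v : ℝ → ℝ) (I : JobSequence) (u : Fin I.n → ℝ → ℝ) (j : Fin I.n) : ℝ :=
  min (finalPrice P v I u j * (I.job j).volume) (I.job j).value

variable (hmono : MonotoneOn (fun u => marginal P (v u)) (Ici 0))
  (hcont : ContinuousOn (fun u => marginal P (v u)) (Ici 0))
  (hu : IsExecution P v I u)

include hu hmono

lemma IsExecution.finalPrice_le {j : Fin I.n} {t : ℝ} (ht : t ∈ (I.job j).window) :
    finalPrice P v I u j ≤ marginal P (v (∑ k, u k t)) := by
  have h0 : ∀ t, 0 ≤ ∑ k ∈ Finset.Iio j, u k t + u j t := fun t =>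
    add_nonneg (Finset.sum_nonneg fun k _ => hu.nonneg k t) (hu.nonneg j t)
  refine (dualPrice_le hmono h0 ht).trans (hmono (h0 t)
    (Finset.sum_nonneg fun k _ => hu.nonneg k t) ?_)
  rw [add_comm, ← Finset.sum_insert (f := fun k => u k t) (by simp)]
  exact Finset.sum_le_sum_of_subset_of_nonneg (Finset.subset_univ _)
    fun k _ _ => hu.nonneg k t

lemma IsExecution.finalPrice_nonneg (hpos : 0 ≤ marginal P (v 0)) (j : Fin I.n) :
    0 ≤ finalPrice P v I u j := by
  refine le_dualPrice fun t _ => hpos.trans ?_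
  have h0 : 0 ≤ ∑ k ∈ Finset.Iio j, u k t + u j t :=
    add_nonneg (Finset.sum_nonneg fun k _ => hu.nonneg k t) (hu.nonneg j t)
  exact hmono self_mem_Ici h0 h0

include hcont

lemma IsExecution.price_eq_of_pos {j : Fin I.n} {t : ℝ} (ht : 0 < u j t) :
    marginal P (v (∑ k ∈ Finset.Iio j, u k t + u j t)) = finalPrice P v I u j := by
  obtain ⟨T, w, hw, h⟩ := hu j
  rw [finalPrice, h]
  rw [h] at ht
  exact hw.price_eq_of_pos hmono hcont
    (fun t => Finset.sum_nonneg fun k _ => hu.nonneg k t) ⟨hw.nonneg, le_rfl⟩ ht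

lemma IsExecution.price_mul_speed (j : Fin I.n) (t : ℝ) :
    marginal P (v (∑ k ∈ Finset.Iio j, u k t + u j t)) * u j t
      = finalPrice P v I u j * u j t := by
  rcases (hu.nonneg j t).eq_or_lt with h | h
  · simp [← h]
  · rw [hu.price_eq_of_pos hmono hcont h]

lemma IsExecution.price_mul_volume_le {j : Fin I.n} {t : ℝ} (ht : 0 < u j t) :
    finalPrice P v I u j * (I.job j).volume ≤ (I.job j).value := by
  obtain ⟨T, w, hw, h⟩ := hu j
  rw [finalPrice, h]
  rw [h] at ht
  exact hw.price_mul_volume_le hmono hcont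
    (fun t => Finset.sum_nonneg fun k _ => hu.nonneg k t) ht

/-- If the job received any virtual speed, then `λ_j p_j ≤ a_j`, so its share is `λ_j p_j`;
otherwise the left side vanishes. -/
lemma IsExecution.price_mul_work_le (hpos : 0 ≤ marginal P (v 0)) (j : Fin I.n) :
    ENNReal.ofReal (finalPrice P v I u j) * (I.job j).work (u j)
      ≤ ENNReal.ofReal (dualShare P v I u j) := by
  by_cases h : ∃ t, 0 < u j t
  · obtain ⟨t, ht⟩ := h
    rw [dualShare, min_eq_left (hu.price_mul_volume_le hmono hcont ht),
      ENNReal.ofReal_mul (hu.finalPrice_nonneg hmono hpos j)]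
    gcongr
    exact hu.work_le j
  · push Not at h
    have : (I.job j).work (u j) = 0 := by
      simp [Job.work, ENNReal.ofReal_eq_zero.2 (h _)]
    simp [this]

omit hcont hmono in
lemma IsExecution.dualShare_eq_of_rejected {j : Fin I.n} (h : ¬ Accepted I u j) :
    dualShare P v I u j = (I.job j).value := by
  obtain ⟨T, w, hw, e⟩ := hu j
  have hexit := hw.exit
  rw [LoopGuard, not_and, not_lt] at hexit
  refine min_eq_right ?_
  rw [finalPrice, e]
  refine hexit ?_
  rw [← e]
  exact not_le.1 h

end Execution

/-! ### The primal-dual bound -/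

section Bound

variable {P v : ℝ → ℝ} {r : ℝ} {I : JobSequence} {u : Fin I.n → ℝ → ℝ}
  (hc : ConvexOn ℝ (Ici 0) P) (hd : DifferentiableOn ℝ P (Ici 0))
  (hnn : ∀ z, 0 ≤ z → 0 ≤ P z) (h0 : P 0 = 0)
  (hv : SolvesSystem P r v) (hr : 1 ≤ r) (hu : IsExecution P v I u)

/-- The defect `-∫ Q(v(t)) dt` of the dual objective. -/
def dualDefect (P v : ℝ → ℝ) (I : JobSequence) (u : Fin I.n → ℝ → ℝ) : ℝ≥0∞ :=
  ∫⁻ t in Ici (0 : ℝ), ENNReal.ofReal (-Q P (v (∑ j, u j t)))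

include hc hd hv hu

lemma measurable_defect :
    Measurable fun t => ENNReal.ofReal (-Q P (v (∑ j, u j t))) := by
  -- Monotonicity is known only on `[0, ∞)`; truncation makes it global, and global monotonicity
  -- gives measurability.
  have hanti : Antitone fun x : ℝ => Q P (v (max x 0)) := fun x y hxy =>
    hv.antitoneOn_Q hc hd (le_max_right x 0) (le_max_right y 0) (max_le_max_right 0 hxy)
  have hsum : Measurable fun t => ∑ j, u j t :=
    Finset.measurable_sum _ fun j _ => hu.measurable j
  have heq : (fun t => Q P (v (∑ j, u j t)))
      = fun t => Q P (v (max (∑ j, u j t) 0)) := by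
    funext t
    rw [max_eq_left (Finset.sum_nonneg fun j _ => hu.nonneg j t)]
  refine Measurable.ennreal_ofReal (Measurable.neg ?_)
  rw [heq]
  exact hanti.measurable.comp hsum

include hnn h0 hr

open Classical in
-- At a fixed time, the jobs are added one by one in order of arrival and the bounds on the
-- increments telescope.
lemma pointwise_cost_le (t : ℝ) :
    P (∑ j, realSpeed I u j t) + r * -Q P (v (∑ j, u j t)) ≤
      ∑ j, (if Accepted I u j then r else r - 1) * (finalPrice P v I u j * u j t) := by
  refine induction_Iio (motive := fun s => P (∑ j ∈ s, realSpeed I u j t)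
    + r * -Q P (v (∑ j ∈ s, u j t)) ≤ ∑ j ∈ s, (if Accepted I u j then r else r - 1)
      * (finalPrice P v I u j * u j t)) ?_ fun j ih => ?_
  · simp [h0, hv.boundary]
  · have hU : 0 ≤ ∑ k ∈ Finset.Iio j, u k t := Finset.sum_nonneg fun k _ => hu.nonneg k t
    have hS : 0 ≤ ∑ k ∈ Finset.Iio j, realSpeed I u k t :=
      Finset.sum_nonneg fun k _ => hu.isSchedule.nonneg k t
    have hSU : ∑ k ∈ Finset.Iio j, realSpeed I u k t ≤ ∑ k ∈ Finset.Iio j, u k t :=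
      Finset.sum_le_sum fun k _ => hu.realSpeed_le k t
    have hx := hu.nonneg j t
    have hprice := hu.price_mul_speed (hv.monotoneOn_price hc hd)
      (hv.continuousOn_price hc hd) j t
    rw [Finset.sum_insert (by simp), Finset.sum_insert (by simp), Finset.sum_insert (by simp),
      add_comm (realSpeed I u j t), add_comm (u j t), ← hprice]
    by_cases h : Accepted I u j
    · rw [if_pos h]
      have h1 := hv.energy_increment hc hd hr hU hx
      have h2 := add_sub_le_add_sub hc hd hS hSU hx
      have hs := hu.realSpeed_le j t
      have hs0 := hu.isSchedule.nonneg j t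
      -- The real speed of an accepted job can differ from the virtual one at the instant of the
      -- deadline; `P` is nondecreasing, so this does no harm.
      have h3 : P (∑ k ∈ Finset.Iio j, realSpeed I u k t + realSpeed I u j t)
          ≤ P (∑ k ∈ Finset.Iio j, realSpeed I u k t + u j t) := by
        have := tangent_le hc hd (y := ∑ k ∈ Finset.Iio j, realSpeed I u k t + realSpeed I u j t)
          (z := ∑ k ∈ Finset.Iio j, realSpeed I u k t + u j t) (by linarith) (by linarith)
        have hm := marginal_nonneg hc hd hnn h0
          (z := ∑ k ∈ Finset.Iio j, realSpeed I u k t + realSpeed I u j t) (by linarith)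
        nlinarith
      linarith
    · have hs : realSpeed I u j t = 0 := by rw [realSpeed, if_neg h]; rfl
      rw [if_neg h, hs, add_zero]
      have h1 := hv.Q_decrement hc hd hr hU hx
      linarith

open Classical in
lemma energy_add_defect_le :
    energy P I (realSpeed I u) + ENNReal.ofReal r * dualDefect P v I u ≤
      ∑ j, ENNReal.ofReal (if Accepted I u j then r else r - 1)
        * ENNReal.ofReal (dualShare P v I u j) := by
  have hmono := hv.monotoneOn_price hc hd
  have hcont := hv.continuousOn_price hc hd
  have hpos : 0 ≤ marginal P (v 0) := marginal_nonneg hc hd hnn h0 (hv.nonneg 0 le_rfl)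
  have hmeas := measurable_defect hc hd hv hu
  have hκ : ∀ j, 0 ≤ (if Accepted I u j then r else r - 1) := fun j => by
    split_ifs <;> linarith
  rw [energy, dualDefect, ← lintegral_const_mul _ hmeas, ← lintegral_add_right _
    (hmeas.const_mul _)]
  calc _ ≤ ∫⁻ t in Ici (0 : ℝ), ∑ j, ENNReal.ofReal (if Accepted I u j then r else r - 1) *
        (ENNReal.ofReal (finalPrice P v I u j) * ENNReal.ofReal (u j t)) := by
        refine lintegral_mono fun t => ?_
        have hQ : 0 ≤ -Q P (v (∑ j, u j t)) := neg_nonneg.2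
          (hv.Q_nonpos hc hd (Finset.sum_nonneg fun j _ => hu.nonneg j t))
        have hP := hnn (∑ j, realSpeed I u j t)
          (Finset.sum_nonneg fun j _ => hu.isSchedule.nonneg j t)
        simp_rw [← ENNReal.ofReal_mul (hu.finalPrice_nonneg hmono hpos _),
          ← ENNReal.ofReal_mul (hκ _)]
        rw [← ENNReal.ofReal_mul (by linarith), ← ENNReal.ofReal_add hP
          (mul_nonneg (by linarith) hQ), ← ENNReal.ofReal_sum_of_nonneg fun j _ =>
            mul_nonneg (hκ j) (mul_nonneg (hu.finalPrice_nonneg hmono hpos j) (hu.nonneg j t))]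
        exact ENNReal.ofReal_le_ofReal (pointwise_cost_le hc hd hnn h0 hv hr hu t)
    _ = ∑ j, ENNReal.ofReal (if Accepted I u j then r else r - 1) *
        (ENNReal.ofReal (finalPrice P v I u j) * (I.job j).work (u j)) := by
        rw [lintegral_finsetSum _ fun j _ =>
          (((hu.measurable j).ennreal_ofReal).const_mul _).const_mul _]
        refine Finset.sum_congr rfl fun j _ => ?_
        rw [lintegral_const_mul _ (((hu.measurable j).ennreal_ofReal).const_mul _),
          lintegral_const_mul _ ((hu.measurable j).ennreal_ofReal),
          Job.work_eq_of_zero_outside (hu.outside j)]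
    _ ≤ _ := by
        gcongr with j _
        exact hu.price_mul_work_le hmono hcont hpos j

/-- A rejected job has share equal to its value, so its lost value raises its factor from `r - 1` to
`r`. -/
lemma cost_add_defect_le :
    cost P I (realSpeed I u) + ENNReal.ofReal r * dualDefect P v I u ≤
      ENNReal.ofReal r * ∑ j, ENNReal.ofReal (dualShare P v I u j) := by
  classical
  have hmono := hv.monotoneOn_price hc hd
  have h := energy_add_defect_le hc hd hnn h0 hv hr hu
  rw [cost, add_right_comm]
  refine (add_le_add_left h _).trans ?_
  rw [lostValue, ← Finset.sum_add_distrib, Finset.mul_sum]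
  refine Finset.sum_le_sum fun j _ => ?_
  by_cases hj : Accepted I u j
  · rw [if_pos hj, if_pos (completed_of_accepted hj), add_zero]
  · rw [if_neg hj, hu.dualShare_eq_of_rejected hj]
    calc _ ≤ ENNReal.ofReal (r - 1) * ENNReal.ofReal (I.job j).value
          + ENNReal.ofReal (I.job j).value := by
          gcongr
          split_ifs
          · exact zero_le
          · exact le_rfl
      _ = ENNReal.ofReal r * ENNReal.ofReal (I.job j).value := by
          rw [← ENNReal.ofReal_mul (by linarith), ← ENNReal.ofReal_mul (by linarith),
            ← ENNReal.ofReal_add (mul_nonneg (by linarith) (I.job j).value_nonneg)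
              (I.job j).value_nonneg]
          congr 1; ring

omit hr in
-- Weak duality. A completed job does work at least `p_j`, each unit priced at `λ_j`; an uncompleted
-- one pays `a_j`.
lemma dual_le_cost_add_defect {s : Fin I.n → ℝ → ℝ} (hs : IsSchedule I s) :
    ∑ j, ENNReal.ofReal (dualShare P v I u j) ≤ cost P I s + dualDefect P v I u := by
  classical
  have hmono := hv.monotoneOn_price hc hd
  have hpos : 0 ≤ marginal P (v 0) := marginal_nonneg hc hd hnn h0 (hv.nonneg 0 le_rfl)
  have hmeas := measurable_defect hc hd hv hu
  have hprice := hu.finalPrice_nonneg hmono hpos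
  have hwork : ∑ j, ENNReal.ofReal (finalPrice P v I u j) * (I.job j).work (s j)
      ≤ energy P I s + dualDefect P v I u := by
    rw [energy, dualDefect, ← lintegral_add_right _ hmeas]
    calc _ = ∫⁻ t in Ici (0 : ℝ), ∑ j, ENNReal.ofReal (finalPrice P v I u j)
          * ENNReal.ofReal (s j t) := by
          rw [lintegral_finsetSum _ fun j _ => ((hs.measurable j).ennreal_ofReal).const_mul _]
          refine Finset.sum_congr rfl fun j _ => ?_
          rw [lintegral_const_mul _ ((hs.measurable j).ennreal_ofReal),
            Job.work_eq_of_zero_outside fun t ht => hs.pending j t fun h =>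
              ht (Ico_subset_Icc_self h)]
      _ ≤ _ := by
          refine lintegral_mono fun t => ?_
          have hU : 0 ≤ ∑ j, u j t := Finset.sum_nonneg fun j _ => hu.nonneg j t
          have hS : 0 ≤ ∑ j, s j t := Finset.sum_nonneg fun j _ => hs.nonneg j t
          have hQ : 0 ≤ -Q P (v (∑ j, u j t)) := neg_nonneg.2 (hv.Q_nonpos hc hd hU)
          simp_rw [← ENNReal.ofReal_mul (hprice _)]
          rw [← ENNReal.ofReal_add (hnn _ hS) hQ, ← ENNReal.ofReal_sum_of_nonneg fun j _ =>
            mul_nonneg (hprice j) (hs.nonneg j t)]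
          refine ENNReal.ofReal_le_ofReal ?_
          calc _ ≤ ∑ j, marginal P (v (∑ k, u k t)) * s j t := by
                refine Finset.sum_le_sum fun j _ => ?_
                by_cases ht : t ∈ (I.job j).pending
                · exact mul_le_mul_of_nonneg_right
                    (hu.finalPrice_le hmono (Ico_subset_Icc_self ht)) (hs.nonneg j t)
                · simp [hs.pending j t ht]
            _ ≤ _ := by
                rw [← Finset.mul_sum]
                -- Tangent at `v(t)`, evaluated at the machine speed of the competing schedule.
                have := tangent_le hc hd (hv.nonneg _ hU) hS
                unfold Q
                linarith
  rw [cost, add_right_comm]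
  refine le_trans ?_ (add_le_add_left hwork _)
  rw [lostValue, ← Finset.sum_add_distrib]
  refine Finset.sum_le_sum fun j _ => ?_
  by_cases hj : Completed I s j
  · rw [if_pos hj, add_zero]
    calc _ ≤ ENNReal.ofReal (finalPrice P v I u j * (I.job j).volume) :=
          ENNReal.ofReal_le_ofReal (min_le_left _ _)
      _ = ENNReal.ofReal (finalPrice P v I u j) * ENNReal.ofReal (I.job j).volume :=
          ENNReal.ofReal_mul (hprice j)
      _ ≤ _ := by gcongr; exact hj
  · rw [if_neg hj]
    exact (ENNReal.ofReal_le_ofReal (min_le_right _ _)).trans le_add_self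

lemma cost_le_mul_cost {s : Fin I.n → ℝ → ℝ} (hs : IsSchedule I s) :
    cost P I (realSpeed I u) ≤ ENNReal.ofReal r * cost P I s := by
  have h1 := cost_add_defect_le hc hd hnn h0 hv hr hu
  have h2 := dual_le_cost_add_defect hc hd hnn h0 hv hu hs
  -- The defect may be cancelled in `ℝ≥0∞` because the finite dual shares bound it.
  have hfin : ENNReal.ofReal r * ∑ j, ENNReal.ofReal (dualShare P v I u j) ≠ ⊤ :=
    ENNReal.mul_ne_top ENNReal.ofReal_ne_top
      (ENNReal.sum_ne_top.2 fun j _ => ENNReal.ofReal_ne_top)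
  have hN : ENNReal.ofReal r * dualDefect P v I u ≠ ⊤ :=
    ne_top_of_le_ne_top hfin (le_add_self.trans h1)
  refine (ENNReal.add_le_add_iff_right hN).1 (h1.trans ?_)
  rw [← mul_add]
  gcongr

end Bound

/-- If idling costs energy, then every schedule has infinite cost. -/
lemma cost_eq_top_of_pos {P : ℝ → ℝ} {I : JobSequence} {s : Fin I.n → ℝ → ℝ} (hP : 0 < P 0)
    (hs : IsSchedule I s) : cost P I s = ⊤ := by
  obtain ⟨D, hD⟩ := (Set.finite_range fun j => (I.job j).deadline).bddAbove
  refine eq_top_iff.2 (le_trans ?_ le_self_add)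
  calc (⊤ : ℝ≥0∞) = ∫⁻ _ in Ici (max D 0), ENNReal.ofReal (P 0) := by
        rw [setLIntegral_const, Real.volume_Ici, ENNReal.mul_top]
        exact (ENNReal.ofReal_pos.2 hP).ne'
    _ = ∫⁻ t in Ici (max D 0), ENNReal.ofReal (P (∑ j, s j t)) := by
        refine setLIntegral_congr_fun measurableSet_Ici fun t ht => ?_
        have : ∑ j, s j t = 0 := Finset.sum_eq_zero fun j _ => hs.pending j t fun h =>
          (h.2.trans_le ((hD ⟨j, rfl⟩).trans ((le_max_left D 0).trans ht))).false
        simp only [this]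
    _ ≤ energy P I s := lintegral_mono_set (Ici_subset_Ici.2 (le_max_right D 0))

lemma cost_le_mul_optimalCost {P v : ℝ → ℝ} {r : ℝ} {I : JobSequence} {u : Fin I.n → ℝ → ℝ}
    (hc : ConvexOn ℝ (Ici 0) P) (hd : DifferentiableOn ℝ P (Ici 0))
    (hnn : ∀ z, 0 ≤ z → 0 ≤ P z) (hv : SolvesSystem P r v) (hr : 1 ≤ r)
    (hu : IsExecution P v I u) :
    cost P I (realSpeed I u) ≤ ENNReal.ofReal r * optimalCost P I := by
  have hr0 : ENNReal.ofReal r ≠ 0 := (ENNReal.ofReal_pos.2 (by linarith)).ne'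
  suffices h : ∀ s, IsSchedule I s → cost P I (realSpeed I u) ≤ ENNReal.ofReal r * cost P I s by
    rw [← ENNReal.div_le_iff' hr0 ENNReal.ofReal_ne_top]
    refine le_iInf₂ fun s hs => ?_
    rw [ENNReal.div_le_iff' hr0 ENNReal.ofReal_ne_top]
    exact h s hs
  intro s hs
  rcases (hnn 0 le_rfl).eq_or_lt with h0 | h0
  · exact cost_le_mul_cost hc hd hnn h0.symm hv hr hu hs
  · rw [cost_eq_top_of_pos h0 hs, ENNReal.mul_top hr0]
    exact le_top

/-! ### Existence of executions -/

section Existence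

/-- The virtual speed that raises the total virtual speed on the window to the level `h`. -/
def waterFilling (J : Job) (U : ℝ → ℝ) (h : ℝ) : ℝ → ℝ :=
  J.window.indicator fun t => max 0 (h - U t)

variable {P v : ℝ → ℝ} {J : Job} {U : ℝ → ℝ} {h : ℝ}

lemma waterFilling_of_mem {t : ℝ} (ht : t ∈ J.window) :
    waterFilling J U h t = max 0 (h - U t) := indicator_of_mem ht _

lemma waterFilling_of_notMem {t : ℝ} (ht : t ∉ J.window) : waterFilling J U h t = 0 :=
  indicator_of_notMem ht _

lemma waterFilling_nonneg (t : ℝ) : 0 ≤ waterFilling J U h t :=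
  indicator_nonneg (fun _ _ => le_max_left _ _) t

lemma add_waterFilling_of_mem {t : ℝ} (ht : t ∈ J.window) :
    U t + waterFilling J U h t = max (U t) h := by
  rw [waterFilling_of_mem ht, ← max_add_add_left, add_zero, add_sub_cancel]

lemma monotone_waterFilling (t : ℝ) : Monotone fun h => waterFilling J U h t := by
  intro a b hab
  by_cases ht : t ∈ J.window
  · simp only [waterFilling_of_mem ht]
    exact max_le_max_left 0 (by linarith)
  · simp only [waterFilling_of_notMem ht, le_refl]

lemma continuous_waterFilling (t : ℝ) : Continuous fun h => waterFilling J U h t := by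
  by_cases ht : t ∈ J.window
  · simp only [waterFilling_of_mem ht]
    fun_prop
  · simp only [waterFilling_of_notMem ht]
    fun_prop

lemma measurable_waterFilling (hU : Measurable U) : Measurable (waterFilling J U h) :=
  (measurable_const.max (measurable_const.sub hU)).indicator measurableSet_Icc

lemma finite_range_add_waterFilling (hfin : (range U).Finite) :
    (range fun t => U t + waterFilling J U h t).Finite := by
  refine (hfin.union (hfin.image fun y => max y h)).subset ?_
  rintro _ ⟨t, rfl⟩
  by_cases ht : t ∈ J.window
  · exact Or.inr ⟨U t, ⟨t, rfl⟩, (add_waterFilling_of_mem ht).symm⟩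
  · exact Or.inl ⟨t, by simp [waterFilling_of_notMem ht]⟩

lemma continuous_work_waterFilling (hUm : Measurable U) (hU : ∀ t, 0 ≤ U t) :
    Continuous fun h => J.work (waterFilling J U h) := by
  have hfm : IsFiniteMeasure (volume.restrict J.window) :=
    ⟨by rw [Measure.restrict_apply_univ]; exact measure_Icc_lt_top⟩
  have hle : ∀ h t, waterFilling J U h t ≤ |h| := by
    intro h t
    by_cases ht : t ∈ J.window
    · rw [waterFilling_of_mem ht]
      exact max_le (abs_nonneg h) (by linarith [le_abs_self h, hU t])
    · rw [waterFilling_of_notMem ht]; exact abs_nonneg h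
  have heq : (fun h => J.work (waterFilling J U h))
      = fun h => ENNReal.ofReal (∫ t in J.window, waterFilling J U h t) := by
    funext h
    rw [Job.work, ofReal_integral_eq_lintegral_ofReal]
    · refine Integrable.of_bound (measurable_waterFilling hUm).aestronglyMeasurable |h|
        (Eventually.of_forall fun t => ?_)
      rw [Real.norm_of_nonneg (waterFilling_nonneg t)]
      exact hle h t
    · exact Eventually.of_forall fun t => waterFilling_nonneg t
  rw [heq]
  refine ENNReal.continuous_ofReal.comp (continuous_iff_continuousAt.2 fun h₀ => ?_)
  -- As `U ≥ 0`, the filling to level `h` is at most `|h|`, which is below `|h₀| + 1` near `h₀`.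
  refine continuousAt_of_dominated (bound := fun _ => |h₀| + 1)
    (Eventually.of_forall fun h => (measurable_waterFilling hUm).aestronglyMeasurable) ?_
    (integrable_const _) (Eventually.of_forall fun t => (continuous_waterFilling t).continuousAt)
  filter_upwards [(continuous_abs.tendsto h₀).eventually_lt_const (lt_add_one |h₀|)] with h hh
  refine Eventually.of_forall fun t => ?_
  rw [Real.norm_of_nonneg (waterFilling_nonneg t)]
  exact (hle h t).trans hh.le

lemma exists_volume_le_work_waterFilling (hfin : (range U).Finite) :
    ∃ h, ENNReal.ofReal J.volume ≤ J.work (waterFilling J U h) := by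
  obtain ⟨M, hM⟩ := hfin.bddAbove
  have hlen : 0 < J.deadline - J.release := sub_pos.2 J.release_lt_deadline
  refine ⟨M + J.volume / (J.deadline - J.release), ?_⟩
  calc ENNReal.ofReal J.volume
      = ∫⁻ _ in J.window, ENNReal.ofReal (J.volume / (J.deadline - J.release)) := by
        rw [setLIntegral_const, Job.window, Real.volume_Icc, ← ENNReal.ofReal_mul
          (div_nonneg J.volume_nonneg hlen.le), div_mul_cancel₀ _ hlen.ne']
    _ ≤ _ := by
        refine setLIntegral_mono' measurableSet_Icc fun t ht => ENNReal.ofReal_le_ofReal ?_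
        rw [waterFilling_of_mem ht]
        refine le_max_of_le_right ?_
        linarith [hM ⟨t, rfl⟩]

variable (hmono : MonotoneOn (fun u => marginal P (v u)) (Ici 0))

include hmono

lemma dualPrice_waterFilling (hU : ∀ t, 0 ≤ U t) {t₀ : ℝ} (ht₀ : t₀ ∈ J.window)
    (hh : U t₀ ≤ h) :
    dualPrice P v J (fun t => U t + waterFilling J U h t) = marginal P (v h) := by
  have hX : ∀ t, 0 ≤ U t + waterFilling J U h t := fun t =>
    add_nonneg (hU t) (waterFilling_nonneg t)
  refine le_antisymm ?_ (le_dualPrice fun t ht => ?_)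
  · refine (dualPrice_le hmono hX ht₀).trans_eq ?_
    rw [add_waterFilling_of_mem ht₀, max_eq_right hh]
  · refine hmono ((hU t₀).trans hh) (hX t) ?_
    rw [add_waterFilling_of_mem ht]
    exact le_max_right _ _

/-- The water level rises from the minimum of `U` on the window until the guard first fails.
Finiteness of the range makes that minimum attained and `U` bounded, and it is inherited by the next
job. -/
lemma exists_isWhileLoop (hcont : ContinuousOn (fun u => marginal P (v u)) (Ici 0))
    (hUm : Measurable U) (hU : ∀ t, 0 ≤ U t) (hfin : (range U).Finite) :
    ∃ T w, IsWhileLoop P v J U T w ∧ (range fun t => U t + w T t).Finite := by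
  obtain ⟨_, ⟨t₀, ht₀, rfl⟩, hmin⟩ := Set.exists_min_image (U '' J.window) id
    (hfin.subset (image_subset_range _ _)) (J.window_nonempty.image _)
  have hmin : ∀ t ∈ J.window, U t₀ ≤ U t := fun t ht => hmin _ ⟨t, ht, rfl⟩
  let S : Set ℝ := {τ | 0 ≤ τ ∧ ¬ LoopGuard P v J U (waterFilling J U (U t₀ + τ))}
  -- Replacing `τ` by `max τ 0` changes nothing on `[0, ∞)` and makes the price continuous on all of
  -- `ℝ`, so that `S` is closed and the first exit moment belongs to it.
  have hS : S = Ici 0 ∩ ({τ | ENNReal.ofReal J.volume ≤ J.work (waterFilling J U (U t₀ + τ))}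
      ∪ {τ | J.value ≤ marginal P (v (U t₀ + max τ 0)) * J.volume}) := by
    ext τ
    simp only [S, mem_inter_iff, mem_union, mem_ofPred_eq, mem_Ici, and_congr_right_iff]
    intro hτ
    rw [LoopGuard, dualPrice_waterFilling hmono hU ht₀ (by linarith), not_and_or, not_lt,
      not_lt, max_eq_left hτ]
  have hclosed : IsClosed S := by
    rw [hS]
    refine isClosed_Ici.inter (IsClosed.union ?_ ?_)
    · exact isClosed_le continuous_const
        ((continuous_work_waterFilling hUm hU).comp (continuous_const.add continuous_id))
    · refine isClosed_le continuous_const (Continuous.mul ?_ continuous_const)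
      refine hcont.comp_continuous (f := fun τ => U t₀ + max τ 0) (by fun_prop) fun τ => ?_
      exact add_nonneg (hU t₀) (le_max_right _ _)
  have hne : S.Nonempty := by
    obtain ⟨h, hh⟩ := exists_volume_le_work_waterFilling (J := J) hfin
    refine ⟨max 0 (h - U t₀), le_max_left _ _, fun hg => hg.1.not_ge (hh.trans ?_)⟩
    refine lintegral_mono fun t => ENNReal.ofReal_le_ofReal (monotone_waterFilling t ?_)
    linarith [le_max_right 0 (h - U t₀)]
  have hbdd : BddBelow S := ⟨0, fun τ hτ => hτ.1⟩
  have hT : sInf S ∈ S := hclosed.csInf_mem hne hbdd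
  refine ⟨sInf S, fun τ => waterFilling J U (U t₀ + τ), ?_, finite_range_add_waterFilling hfin⟩
  exact
    { nonneg := hT.1
      init := fun t => by
        by_cases ht : t ∈ J.window
        · rw [waterFilling_of_mem ht, max_eq_left]
          linarith [hmin t ht]
        · exact waterFilling_of_notMem ht
      measurable := fun τ _ => measurable_waterFilling hUm
      outside := fun τ _ t ht => waterFilling_of_notMem ht
      monotoneOn := fun t σ _ τ _ hστ => monotone_waterFilling t (by linarith)
      continuousOn := fun t =>
        ((continuous_waterFilling t).comp (continuous_const.add continuous_id)).continuousOn
      increase_argMin := fun t σ hσ τ hτ hστ hlt => by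
        have hpos : 0 < waterFilling J U (U t₀ + τ) t := (waterFilling_nonneg t).trans_lt hlt
        have ht : t ∈ J.window := by
          by_contra h
          rw [waterFilling_of_notMem h] at hpos
          exact hpos.false
        -- A time with positive filling lies exactly at the water level, the lowest level in the
        -- window, so `τ` itself is a witness.
        refine ⟨τ, ⟨hστ, le_rfl⟩, ht, fun t' ht' => ?_⟩
        rw [waterFilling_of_mem ht, lt_max_iff, sub_pos] at hpos
        have hlev : U t ≤ U t₀ + τ := (hpos.resolve_left (lt_irrefl 0)).le
        have h0 : 0 ≤ U t₀ + τ := add_nonneg (hU t₀) hτ.1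
        beta_reduce
        rw [add_waterFilling_of_mem ht, add_waterFilling_of_mem ht', max_eq_right hlev]
        exact hmono h0 (h0.trans (le_max_right _ _)) (le_max_right _ _)
      guard := fun τ hτ => by
        by_contra hg
        exact notMem_of_lt_csInf hτ.2 hbdd ⟨hτ.1, hg⟩
      exit := hT.2 }

lemma exists_isExecution (hcont : ContinuousOn (fun u => marginal P (v u)) (Ici 0))
    (I : JobSequence) : ∃ u, IsExecution P v I u := by
  suffices h : ∃ u : Fin I.n → ℝ → ℝ, (∀ j ∈ Finset.univ, ∃ T w, IsWhileLoop P v (I.job j)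
      (fun t => ∑ k ∈ Finset.Iio j, u k t) T w ∧ u j = w T) ∧
      (range fun t => ∑ k, u k t).Finite by
    obtain ⟨u, hu, -⟩ := h
    exact ⟨u, fun j => hu j (Finset.mem_univ j)⟩
  refine induction_Iio (motive := fun s => ∃ u : Fin I.n → ℝ → ℝ, (∀ j ∈ s, ∃ T w,
    IsWhileLoop P v (I.job j) (fun t => ∑ k ∈ Finset.Iio j, u k t) T w ∧ u j = w T) ∧
      (range fun t => ∑ k ∈ s, u k t).Finite) ⟨fun _ _ => 0, by simp, ?_⟩ ?_
  · simp
  rintro j ⟨u, hu, hfin⟩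
  have hm : ∀ k ∈ Finset.Iio j, Measurable (u k) := fun k hk => by
    obtain ⟨T, w, hw, e⟩ := hu k hk
    exact e ▸ hw.measurable T ⟨hw.nonneg, le_rfl⟩
  have hn : ∀ k ∈ Finset.Iio j, ∀ t, 0 ≤ u k t := fun k hk t => by
    obtain ⟨T, w, hw, e⟩ := hu k hk
    exact e ▸ hw.speed_nonneg ⟨hw.nonneg, le_rfl⟩ t
  obtain ⟨T, w, hw, hfin'⟩ := exists_isWhileLoop (J := I.job j) hmono hcont
    (Finset.measurable_sum _ hm) (fun t => Finset.sum_nonneg fun k hk => hn k hk t) hfin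
  have hupd : ∀ k ≤ j, ∀ t, ∑ i ∈ Finset.Iio k, Function.update u j (w T) i t
      = ∑ i ∈ Finset.Iio k, u i t := fun k hk t =>
    Finset.sum_congr rfl fun i hi => by
      rw [Function.update_of_ne ((Finset.mem_Iio.1 hi).trans_le hk).ne]
  refine ⟨Function.update u j (w T), fun k hk => ?_, ?_⟩
  · rcases Finset.mem_insert.1 hk with rfl | hk
    · simp only [hupd k le_rfl, Function.update_self]
      exact ⟨T, w, hw, rfl⟩
    · have hkj := Finset.mem_Iio.1 hk
      simp only [hupd k hkj.le, Function.update_of_ne hkj.ne]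
      exact hu k hk
  · have : ∀ t, ∑ k ∈ insert j (Finset.Iio j), Function.update u j (w T) k t
        = ∑ k ∈ Finset.Iio j, u k t + w T t := fun t => by
      rw [Finset.sum_insert (by simp), Function.update_self, hupd j le_rfl, add_comm]
    simpa only [this] using hfin'

end Existence

/-- The algorithm is `r`-competitive for every solution of the system with constant `r`. -/
lemma SolvesSystem.algorithmCompetitive {P v : ℝ → ℝ} {r : ℝ}
    (hc : ConvexOn ℝ (Ici 0) P) (hd : DifferentiableOn ℝ P (Ici 0))
    (hnn : ∀ z, 0 ≤ z → 0 ≤ P z) (hr : 1 ≤ r) (hv : SolvesSystem P r v) :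
    AlgorithmCompetitive P v r := fun I =>
  ⟨exists_isExecution (hv.monotoneOn_price hc hd) (hv.continuousOn_price hc hd) I,
    fun _ hu => ⟨hu.isSchedule, fun _ h => completed_of_accepted h,
      cost_le_mul_optimalCost hc hd hnn hv hr hu⟩⟩

/-! ### Power functions -/

section Power

variable {α : ℝ}

lemma differentiable_rpow_const (hα : 1 ≤ α) : Differentiable ℝ fun z : ℝ => z ^ α :=
  fun z => (Real.hasDerivAt_rpow_const (x := z) (Or.inr hα)).differentiableAt

lemma marginal_rpow (hα : 1 ≤ α) {z : ℝ} (hz : 0 ≤ z) :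
    marginal (fun z : ℝ => z ^ α) z = α * z ^ (α - 1) :=
  (Real.hasDerivAt_rpow_const (Or.inr hα)).hasDerivWithinAt.derivWithin
    (uniqueDiffOn_Ici 0 z hz)

lemma Q_rpow (hα : 1 ≤ α) {z : ℝ} (hz : 0 ≤ z) :
    Q (fun z : ℝ => z ^ α) z = (1 - α) * z ^ α := by
  rw [Q, marginal_rpow hα hz]
  rcases hz.eq_or_lt with rfl | hz
  · rw [Real.zero_rpow (by linarith)]; ring
  · rw [Real.rpow_sub_one hz.ne']
    field_simp

lemma hasDerivAt_Q_rpow (hα : 1 ≤ α) {z : ℝ} (hz : 0 < z) :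
    HasDerivAt (Q fun z : ℝ => z ^ α) ((1 - α) * (α * z ^ (α - 1))) z := by
  refine ((Real.hasDerivAt_rpow_const (p := α) (Or.inr hα)).const_mul
    (1 - α)).congr_of_eventuallyEq ?_
  filter_upwards [Ioi_mem_nhds hz] with y hy using Q_rpow hα (le_of_lt hy)

lemma le_rpow_self (hα : 1 ≤ α) : α ≤ α ^ α := by
  simpa using Real.rpow_le_rpow_of_exponent_le hα hα

/-- The first inequality holds with equality, and the second reduces to `α ≤ α ^ α`. -/
lemma solvesSystem_rpow (hα : 1 ≤ α) :
    SolvesSystem (fun z : ℝ => z ^ α) (α ^ α) fun u => u / α := by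
  have hα0 : 0 < α := by linarith
  have hr : 0 < α ^ α := Real.rpow_pos_of_pos hα0 α
  have hder : ∀ u : ℝ, HasDerivAt (fun u => u / α) (1 / α) u := fun u =>
    (hasDerivAt_id u).div_const α
  have hpow : ∀ u : ℝ, 0 < u → α ^ α * (u / α) ^ (α - 1) = α * u ^ (α - 1) := fun u hu => by
    rw [Real.div_rpow hu.le hα0.le, Real.rpow_sub_one hα0.ne' α]
    field_simp
  have hmain : ∀ u : ℝ, 0 < u →
      (1 - α) * (α * (u / α) ^ (α - 1)) * (1 / α) = (1 - α) * (u / α) ^ (α - 1) := fun u _ => by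
    field_simp
  refine ⟨fun u hu => div_nonneg hu hα0.le, by fun_prop, ?_, fun u _ => (hder u).differentiableAt,
    fun u hu => (hasDerivAt_Q_rpow hα (div_pos hu hα0)).differentiableAt, fun u hu => ?_,
    fun u hu => ?_, fun u _ => ?_⟩
  · rw [zero_div, Q_rpow hα le_rfl, Real.zero_rpow hα0.ne', mul_zero]
  · rw [(hasDerivAt_Q_rpow hα (div_pos hu hα0)).deriv, (hder u).deriv, marginal_rpow hα hu.le,
      marginal_rpow hα (div_pos hu hα0).le, hmain u hu, div_le_iff₀ hr, ← hpow u hu]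
    exact le_of_eq (by ring)
  · rw [(hasDerivAt_Q_rpow hα (div_pos hu hα0)).deriv, (hder u).deriv, marginal_rpow hα hu.le,
      hmain u hu]
    have h1 := hpow u hu
    have h2 : 0 < α * u ^ (α - 1) := mul_pos hα0 (Real.rpow_pos_of_pos hu _)
    have h3 := le_rpow_self hα
    calc (0 : ℝ) ≤ (α ^ α - α) * (α * u ^ (α - 1)) := mul_nonneg (by linarith) h2.le
      _ = (α ^ α - 1) * (α * u ^ (α - 1)) + (1 - α) * (α ^ α * (u / α) ^ (α - 1)) := by
          rw [h1]; ring
      _ = _ := by ring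
  · rw [(hder u).deriv]; positivity

/-- A form of the weighted inequality of arithmetic and geometric means. -/
lemma rpow_mul_slack_le (hα : 1 ≤ α) {c g y : ℝ} (hc : 0 < c) (hg : 0 < g)
    (h : c ^ α ≤ g ^ (α - 1) * y) : α * c - (α - 1) * g ≤ y := by
  -- Bernoulli's inequality at `c / g`, to be multiplied by `g ^ α`.
  have hb : 1 + α * (c / g - 1) ≤ (1 + (c / g - 1)) ^ α :=
    one_add_mul_self_le_rpow_one_add (by linarith [div_pos hc hg]) hα
  rw [add_sub_cancel, Real.div_rpow hc.le hg.le, le_div_iff₀ (Real.rpow_pos_of_pos hg α)] at hb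
  have hgp := Real.rpow_pos_of_pos hg (α - 1)
  have e : g ^ α = g ^ (α - 1) * g := by rw [Real.rpow_sub_one hg.ne']; field_simp
  have hb' : g ^ (α - 1) * (α * c - (α - 1) * g) ≤ g ^ (α - 1) * y := by
    refine le_trans (le_of_eq ?_) (hb.trans h)
    rw [e]; field_simp; ring
  exact le_of_mul_le_mul_left hb' hgp

lemma le_of_solvesSystem_rpow (hα : 1 < α) {r : ℝ} (hr : 1 ≤ r) {v : ℝ → ℝ}
    (hv : SolvesSystem (fun z : ℝ => z ^ α) r v) : α ^ α ≤ r := by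
  by_contra! hlt
  have hr0 : 0 < r := by linarith
  have hα0 : 0 < α := by linarith
  have hvpos : ∀ u, 0 < u → 0 < v u := fun u hu =>
    (hv.nonneg 0 le_rfl).trans_lt (strictMonoOn_of_deriv_pos (convex_Ici 0) hv.continuousOn
      (fun x hx => hv.increasing x (by rwa [interior_Ici] at hx)) self_mem_Ici hu.le hu)
  -- With `g = v(u)/u`, the first inequality reads `c ^ α ≤ g ^ (α - 1) * (1 - (α - 1) v')`, and `r
  -- < α ^ α` means `α c > 1`.
  set c : ℝ := (1 / r) ^ (1 / α) with hcdef
  have hc : 0 < c := Real.rpow_pos_of_pos (by positivity) _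
  have hcα : c ^ α = 1 / r := by
    rw [hcdef, ← Real.rpow_mul (by positivity), one_div_mul_cancel hα0.ne', Real.rpow_one]
  have hαc : 1 < α * c := by
    by_contra! hle
    have h1 : (α * c) ^ α ≤ 1 := Real.rpow_le_one (by positivity) hle hα0.le
    rw [Real.mul_rpow hα0.le hc.le, hcα, mul_one_div, div_le_one hr0] at h1
    linarith
  set ε : ℝ := (α * c - 1) / (α - 1) with hε
  have hεpos : 0 < ε := div_pos (by linarith) (by linarith)
  have hderiv : ∀ u, 0 < u → deriv v u ≤ v u / u - ε := by
    intro u hu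
    have h := hv.accept u hu
    rw [marginal_rpow hα.le hu.le, marginal_rpow hα.le (hvpos u hu).le,
      (hasDerivAt_Q_rpow hα.le (hvpos u hu)).deriv] at h
    have hup := Real.rpow_pos_of_pos hu (α - 1)
    have hg : c ^ α ≤ (v u / u) ^ (α - 1) * (1 - (α - 1) * deriv v u) := by
      rw [hcα, Real.div_rpow (hvpos u hu).le hu.le, div_mul_eq_mul_div, le_div_iff₀ hup]
      refine le_of_mul_le_mul_left ?_ hα0
      calc α * (1 / r * u ^ (α - 1)) = α * u ^ (α - 1) / r := by ring
        _ ≤ _ := h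
        _ = _ := by ring
    have h2 := rpow_mul_slack_le hα.le hc (div_pos (hvpos u hu) hu) hg
    have h3 : (α - 1) * ε = α * c - 1 := by
      rw [hε, mul_div_cancel₀ _ (by linarith)]
    have h4 : (α - 1) * deriv v u ≤ (α - 1) * (v u / u - ε) := by linarith
    exact le_of_mul_le_mul_left h4 (by linarith)
  -- The bound `v' ≤ v/u - ε` says that `(v/u)' ≤ -ε/u`.
  have hanti : AntitoneOn (fun u => v u / u + ε * Real.log u) (Ici 1) := by
    have hd : ∀ u : ℝ, 0 < u → HasDerivAt (fun u => v u / u + ε * Real.log u)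
        ((deriv v u * u - v u * 1) / u ^ 2 + ε * u⁻¹) u := fun u hu =>
      ((hv.differentiableAt u hu).hasDerivAt.div (hasDerivAt_id u) hu.ne').add
        ((Real.hasDerivAt_log hu.ne').const_mul ε)
    refine antitoneOn_of_hasDerivWithinAt_nonpos (convex_Ici 1)
      (f' := fun u => (deriv v u * u - v u * 1) / u ^ 2 + ε * u⁻¹)
      (fun u hu => (hd u (by linarith [mem_Ici.1 hu])).continuousAt.continuousWithinAt)
      (fun u hu => ?_) fun u hu => ?_
    · rw [interior_Ici] at hu
      exact (hd u (by linarith [mem_Ioi.1 hu])).hasDerivWithinAt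
    · rw [interior_Ici] at hu
      have hu0 : 0 < u := by linarith [mem_Ioi.1 hu]
      have e : (deriv v u * u - v u * 1) / u ^ 2 + ε * u⁻¹
          = (deriv v u - (v u / u - ε)) * u⁻¹ := by field_simp; ring
      simp only [e]
      exact mul_nonpos_of_nonpos_of_nonneg (by linarith [hderiv u hu0]) (inv_nonneg.2 hu0.le)
  have hv1 := hvpos 1 one_pos
  -- At `u = exp(v(1)/ε)` the logarithmic term has used up the initial value `v(1)`, which forces
  -- `v(u)/u ≤ 0`.
  have hE : 1 ≤ Real.exp (v 1 / ε) := Real.one_le_exp (by positivity)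
  have h := hanti self_mem_Ici hE hE
  simp only [Real.log_exp, Real.log_one, mul_zero, add_zero, div_one,
    mul_div_cancel₀ _ hεpos.ne'] at h
  have := div_pos (hvpos _ (Real.exp_pos (v 1 / ε))) (Real.exp_pos (v 1 / ε))
  linarith

lemma isLeast_solvableConstants_rpow (hα : 1 ≤ α) :
    IsLeast (solvableConstants fun z : ℝ => z ^ α) (α ^ α) := by
  refine ⟨⟨hα.trans (le_rpow_self hα), _, solvesSystem_rpow hα⟩, ?_⟩
  rintro r ⟨hr, v, hv⟩
  rcases hα.eq_or_lt with rfl | hα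
  · simpa using hr
  · exact le_of_solvesSystem_rpow hα hr hv

end Power

end EnergyPlusLostValue

end

theorem mainTheorem1 :
    (∀ P : ℝ → ℝ, ConvexOn ℝ (Set.Ici 0) P → DifferentiableOn ℝ P (Set.Ici 0) →
      (∀ z, 0 ≤ z → 0 ≤ P z) →
      ∀ rstar : ℝ, IsLeast (EnergyPlusLostValue.solvableConstants P) rstar →
        ∀ v : ℝ → ℝ, EnergyPlusLostValue.SolvesSystem P rstar v →
          EnergyPlusLostValue.AlgorithmCompetitive P v rstar) ∧
    (∀ α : ℝ, 1 ≤ α →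
      IsLeast (EnergyPlusLostValue.solvableConstants (fun z : ℝ => z ^ α)) (α ^ α) ∧
      ∀ v : ℝ → ℝ, EnergyPlusLostValue.SolvesSystem (fun z : ℝ => z ^ α) (α ^ α) v →
        EnergyPlusLostValue.AlgorithmCompetitive (fun z : ℝ => z ^ α) v (α ^ α)) := by
  refine ⟨fun P hc hd hnn r hr v hv => hv.algorithmCompetitive hc hd hnn hr.1.1,
    fun α hα => ⟨EnergyPlusLostValue.isLeast_solvableConstants_rpow hα, fun v hv => ?_⟩⟩
  exact hv.algorithmCompetitive (convexOn_rpow hα)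
    (EnergyPlusLostValue.differentiable_rpow_const hα).differentiableOn
    (fun z hz => Real.rpow_nonneg hz α) (hα.trans (EnergyPlusLostValue.le_rpow_self hα))
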